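/- Let $G$ be a connected simple graph, finite or infinite, with vertex set $V_G$ and path distance $d_G$, whose vertex degrees are uniformly bounded ($\Delta_G<\infty$). Write $B(v,r)=\{w\in V_G: d_G(v,w)\le r\}$. A measure on $G$ is given by a weight $\mu:V_G\to(0,\infty)$, with $\mu(S)=\sum_{v\in S}\mu(v)$ for $S\subset V_G$; it is doubling if $$C_\mu=\sup_{v\in V_G,\ r\ge 0}\frac{\mu(B(v,2r))}{\mu(B(v,r))}<\infty .$$ Put $$C_\mu^0=\sup_{v\in V_G}\frac{\mu(B(v,1))}{\mu(B(v,0))}\in[1,\infty],$$ and let $C_G^0$ be the infimum of $C^0_\mu$ over all doubling measures $\mu$ on $G$. Let $r(A_G)$ be the spectral radius of the adjacency operator $A_G:\ell_2(V_G)\to\ell_2(V_G)$, $(A_Gf)(v)=\sum_{w\sim v}f(w)$ (real or complex scalars). Then: 1. If $G$ supports at least one doubling measure, then $$C_G^0=1+r(A_G).$$ 2. Without assuming that $G$ supports a doubling measure, $$\inf\{C^0_\mu:\ \mu \text{ a measure on } G\}=1+r(A_G),$$ the infimum being over all positive weights $\mu$, doubling or not. -/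

import Mathlib

open scoped NNReal ENNReal

noncomputable section

namespace GraphDoubling

variable {V : Type*}

/-- `Δ_G < ∞`: the degrees of the vertices are uniformly bounded. -/
def BoundedDegree (G : SimpleGraph V) [G.LocallyFinite] : Prop :=
  ∃ D : ℕ, ∀ v, G.degree v ≤ D

/-- The closed ball `B(v, r)` for the path distance of `G`. -/
def closedBall (G : SimpleGraph V) (v : V) (r : ℝ) : Set V :=
  {w | (G.dist v w : ℝ) ≤ r}

/-- A measure on a graph is given by a strictly positive (finite) weight on the vertices. -/
def IsWeight (μ : V → ℝ≥0) : Prop :=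
  ∀ v, 0 < μ v

/-- `μ(S) = ∑_{v ∈ S} μ(v)`, as an extended nonnegative real. -/
def mass (μ : V → ℝ≥0) (S : Set V) : ℝ≥0∞ :=
  ∑' v : S, (μ v : ℝ≥0∞)

/-- The doubling constant `C_μ`: the supremum of `μ(B(v, 2r)) / μ(B(v, r))` over all vertices `v`
and all real `r ≥ 0`. -/
def doublingConst (G : SimpleGraph V) (μ : V → ℝ≥0) : ℝ≥0∞ :=
  ⨆ (v : V) (r : ℝ) (_ : 0 ≤ r), mass μ (closedBall G v (2 * r)) / mass μ (closedBall G v r)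

/-- `μ` is a doubling measure on `G`. -/
def IsDoubling (G : SimpleGraph V) (μ : V → ℝ≥0) : Prop :=
  IsWeight μ ∧ doublingConst G μ < ∞

/-- The restricted doubling constant `C_μ^k = sup_v μ(B(v, 2k+1)) / μ(B(v, k))`. -/
def restrictedConst (G : SimpleGraph V) (k : ℕ) (μ : V → ℝ≥0) : ℝ≥0∞ :=
  ⨆ v : V, mass μ (closedBall G v (2 * k + 1)) / mass μ (closedBall G v k)

/-- `C_G^k`: the infimum of `C_μ^k` over all doubling measures `μ` on `G`
(it is `∞` if there is no doubling measure on `G`). -/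
def leastRestrictedConst (G : SimpleGraph V) (k : ℕ) : ℝ≥0∞ :=
  ⨅ (μ : V → ℝ≥0) (_ : IsDoubling G μ), restrictedConst G k μ

/-- The infimum of `C_μ^k` over all measures `μ` on `G`, doubling or not. -/
def leastRestrictedConstAll (G : SimpleGraph V) (k : ℕ) : ℝ≥0∞ :=
  ⨅ (μ : V → ℝ≥0) (_ : IsWeight μ), restrictedConst G k μ

theorem sum_norm_sq_adj_le {𝕜 : Type*} [RCLike 𝕜] (G : SimpleGraph V) [G.LocallyFinite] {D : ℕ}
    (hD : ∀ v, G.degree v ≤ D) (f : lp (fun _ : V => 𝕜) 2) (s : Finset V) :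
    ∑ v ∈ s, ‖∑ w ∈ G.neighborFinset v, f w‖ ^ (2 : ℝ≥0∞).toReal
      ≤ (D * ‖f‖) ^ (2 : ℝ≥0∞).toReal := by
  classical
  have h2 : (2 : ℝ≥0∞).toReal = ((2 : ℕ) : ℝ) := by simp
  have hf : ∀ t : Finset V, ∑ w ∈ t, ‖f w‖ ^ 2 ≤ ‖f‖ ^ 2 := by
    intro t
    have := lp.sum_rpow_le_norm_rpow (p := 2) (by simp) f t
    simpa only [h2, Real.rpow_natCast] using this
  simp only [h2, Real.rpow_natCast]
  have h1 : ∀ v, ‖∑ w ∈ G.neighborFinset v, f w‖ ^ 2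
      ≤ D * ∑ w ∈ G.neighborFinset v, ‖f w‖ ^ 2 := by
    intro v
    calc ‖∑ w ∈ G.neighborFinset v, f w‖ ^ 2
        ≤ (∑ w ∈ G.neighborFinset v, ‖f w‖) ^ 2 := by
          gcongr
          exact norm_sum_le _ _
      _ ≤ (G.neighborFinset v).card * ∑ w ∈ G.neighborFinset v, ‖f w‖ ^ 2 :=
          sq_sum_le_card_mul_sum_sq
      _ ≤ D * ∑ w ∈ G.neighborFinset v, ‖f w‖ ^ 2 := by
          gcongr
          rw [G.card_neighborFinset_eq_degree]
          exact hD v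
  set t : Finset V := s.biUnion fun v => G.neighborFinset v
  have h3 : ∑ v ∈ s, ∑ w ∈ G.neighborFinset v, ‖f w‖ ^ 2 ≤ D * ∑ w ∈ t, ‖f w‖ ^ 2 := by
    rw [Finset.sum_comm' (t' := t) (s' := fun w => s.filter fun v => G.Adj v w)
      (by
        intro v w
        simp only [t, Finset.mem_biUnion, Finset.mem_filter, SimpleGraph.mem_neighborFinset]
        exact ⟨fun h => ⟨h, v, h⟩, fun h => h.1⟩), Finset.mul_sum]
    refine Finset.sum_le_sum fun w _ => ?_
    rw [Finset.sum_const, nsmul_eq_mul]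
    gcongr
    refine le_trans (Finset.card_le_card ?_) ((G.card_neighborFinset_eq_degree w).trans_le (hD w))
    intro v hv
    simpa [SimpleGraph.adj_comm] using (Finset.mem_filter.1 hv).2
  calc ∑ v ∈ s, ‖∑ w ∈ G.neighborFinset v, f w‖ ^ 2
      ≤ ∑ v ∈ s, D * ∑ w ∈ G.neighborFinset v, ‖f w‖ ^ 2 := Finset.sum_le_sum fun v _ => h1 v
    _ = D * ∑ v ∈ s, ∑ w ∈ G.neighborFinset v, ‖f w‖ ^ 2 := by rw [Finset.mul_sum]
    _ ≤ D * (D * ‖f‖ ^ 2) := by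
        gcongr
        exact h3.trans (by gcongr; exact hf t)
    _ = (D * ‖f‖) ^ 2 := by ring

/-- The adjacency operator `A_G : ℓ₂(V) → ℓ₂(V)`, `(A_G f)(v) = ∑_{w ∼ v} f(w)`, of a graph of
bounded degree, as a bounded operator. -/
def adjacencyOperator (𝕜 : Type*) [RCLike 𝕜] (G : SimpleGraph V) [G.LocallyFinite]
    (hG : BoundedDegree G) : lp (fun _ : V => 𝕜) 2 →L[𝕜] lp (fun _ : V => 𝕜) 2 :=
  LinearMap.mkContinuousOfExistsBound
    { toFun := fun f => ⟨fun v => ∑ w ∈ G.neighborFinset v, f w,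
        memℓp_gen' (sum_norm_sq_adj_le G hG.choose_spec f)⟩
      map_add' := fun f g => by
        ext v
        exact Finset.sum_add_distrib
      map_smul' := fun c f => by
        ext v
        simp [Finset.mul_sum] }
    ⟨hG.choose, fun f => lp.norm_le_of_forall_sum_le (by simp) (by positivity)
      (sum_norm_sq_adj_le G hG.choose_spec f)⟩

theorem adjacencyOperator_apply (𝕜 : Type*) [RCLike 𝕜] (G : SimpleGraph V) [G.LocallyFinite]
    (hG : BoundedDegree G) (f : lp (fun _ : V => 𝕜) 2) (v : V) :
    adjacencyOperator 𝕜 G hG f v = ∑ w ∈ G.neighborFinset v, f w :=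
  rfl

end GraphDoubling

end

/-! Balls of radius 0 and 1 are a point and its closed neighbourhood, so `C_μ^0 ≤ 1 + c` means
exactly `A μ ≤ c μ` pointwise (`restrictedConst_zero_le_iff`).

Lower bound: by the Schur test, a positive `μ` with `A μ ≤ c μ` forces `‖A‖ ≤ c`, and `‖A‖` is the
spectral radius because `A` is symmetric.

Upper bound: for `s > ‖A‖` the series `μ = ∑ₙ s⁻ⁿ Aⁿ ν` satisfies `A μ ≤ s μ`. With `ν` a point mass
it converges because the entries of `Aⁿ` are at most `‖A‖ ^ n`, and it is positive because the graph
is connected. With `ν` doubling, `Aⁿ` sees only balls of radius `n`, whose mass grows polynomially,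
so geometric decay gives `ν ≤ μ ≤ K ν` and `μ` is again doubling. Finally `s` decreases to `‖A‖`. -/

namespace GraphDoubling

/-! ### Symmetric operators: norm and spectral radius -/

section SelfAdjoint

variable {𝕜 E : Type*} [RCLike 𝕜] [NormedAddCommGroup E] [InnerProductSpace 𝕜 E]

/-- Expand the square; symmetry evaluates the cross term. Vectors that nearly attain the norm are
thus approximate eigenvectors of `T²` for `‖T‖²`. -/
theorem norm_sq_apply_apply_sub_le {T : E →L[𝕜] E}
    (hT : ∀ x y, inner 𝕜 (T x) y = inner 𝕜 x (T y)) (x : E) :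
    ‖T (T x) - ((‖T‖ ^ 2 : ℝ) : 𝕜) • x‖ ^ 2 ≤ ‖T‖ ^ 2 * (‖T‖ ^ 2 * ‖x‖ ^ 2 - ‖T x‖ ^ 2) := by
  have h1 : RCLike.re (inner 𝕜 (T (T x)) (((‖T‖ ^ 2 : ℝ) : 𝕜) • x)) = ‖T‖ ^ 2 * ‖T x‖ ^ 2 := by
    rw [inner_smul_right, RCLike.re_ofReal_mul, hT, inner_self_eq_norm_sq]
  have h2 : ‖T (T x)‖ ^ 2 ≤ (‖T‖ * ‖T x‖) ^ 2 := by
    gcongr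
    exact T.le_opNorm _
  have h3 : ‖((‖T‖ ^ 2 : ℝ) : 𝕜) • x‖ = ‖T‖ ^ 2 * ‖x‖ := by
    rw [norm_smul, RCLike.norm_ofReal, abs_of_nonneg (by positivity)]
  rw [@norm_sub_sq 𝕜, h1, h3]
  nlinarith

/-- The spectral radius of a symmetric operator, over the reals or the complex numbers, is at least
its norm. -/
theorem nnnorm_le_spectralRadius {T : E →L[𝕜] E}
    (hT : ∀ x y, inner 𝕜 (T x) y = inner 𝕜 x (T y)) :
    (‖T‖₊ : ℝ≥0∞) ≤ spectralRadius 𝕜 T := by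
  have key : ∀ k : 𝕜, ‖k‖₊ = ‖T‖₊ → k ∈ spectrum 𝕜 T → (‖T‖₊ : ℝ≥0∞) ≤ spectralRadius 𝕜 T := by
    intro k hk hmem
    rw [← hk]
    exact le_iSup₂ (f := fun (k : 𝕜) (_ : k ∈ spectrum 𝕜 T) => (‖k‖₊ : ℝ≥0∞)) k hmem
  by_cases hp : ((‖T‖ : ℝ) : 𝕜) ∈ spectrum 𝕜 T
  · exact key _ (by ext; simp) hp
  by_cases hm : ((-‖T‖ : ℝ) : 𝕜) ∈ spectrum 𝕜 T
  · exact key _ (by ext; simp) hm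
  -- If neither `‖T‖` nor `-‖T‖` is spectral, `T² - ‖T‖² = (‖T‖ - T)(-‖T‖ - T)` has a bounded
  -- inverse, which excludes approximate eigenvectors. No complex spectral radius formula enters, so
  -- real scalars are covered.
  rw [spectrum.notMem_iff] at hp hm
  obtain ⟨u, hu⟩ := hp.mul hm
  set S : E →L[𝕜] E := ↑u⁻¹
  have hS : ∀ x, S (T (T x) - ((‖T‖ ^ 2 : ℝ) : 𝕜) • x) = x := by
    intro x
    have h := congrArg (fun R : E →L[𝕜] E => R x) u.inv_mul
    rw [hu] at h
    have h2 : T (T x) - ((‖T‖ ^ 2 : ℝ) : 𝕜) • x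
        = ((algebraMap 𝕜 (E →L[𝕜] E) ((‖T‖ : ℝ) : 𝕜) - T)
          * (algebraMap 𝕜 (E →L[𝕜] E) ((-‖T‖ : ℝ) : 𝕜) - T)) x := by
      simp [Algebra.algebraMap_eq_smul_one, smul_smul, smul_sub, pow_two]
      abel
    rw [h2]
    exact h
  rcases (norm_nonneg T).eq_or_lt with h0 | h0
  · simp [show ‖T‖₊ = 0 from NNReal.eq h0.symm]
  set N := ‖T‖
  set K := ‖S‖ + 1
  have hK : 0 < K := by positivity
  have h1 : ∀ x, ‖x‖ ^ 2 ≤ K ^ 2 * (N ^ 2 * (N ^ 2 * ‖x‖ ^ 2 - ‖T x‖ ^ 2)) := by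
    intro x
    calc ‖x‖ ^ 2 = ‖S (T (T x) - ((N ^ 2 : ℝ) : 𝕜) • x)‖ ^ 2 := by rw [hS]
      _ ≤ (K * ‖T (T x) - ((N ^ 2 : ℝ) : 𝕜) • x‖) ^ 2 := by
          gcongr
          exact (S.le_opNorm _).trans (by gcongr; simp [K])
      _ ≤ _ := by
          rw [mul_pow]
          gcongr
          exact norm_sq_apply_apply_sub_le hT x
  set c := K ^ 2 * N ^ 2
  have hc : 0 < c := by positivity
  -- The bounded inverse leaves a gap `1 / c` below `N ^ 2`, contradicting that `N` is the operator
  -- norm.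
  have h2 : ∀ x, ‖T x‖ ≤ √(N ^ 2 - 1 / c) * ‖x‖ := by
    intro x
    have h3 : ‖T x‖ ^ 2 ≤ (N ^ 2 - 1 / c) * ‖x‖ ^ 2 := by
      have h4 := h1 x
      rw [← mul_assoc] at h4
      have h5 : 1 / c * ‖x‖ ^ 2 ≤ N ^ 2 * ‖x‖ ^ 2 - ‖T x‖ ^ 2 := by
        rw [one_div, inv_mul_le_iff₀ hc]
        exact h4
      linarith
    rw [← Real.sqrt_sq (norm_nonneg x), ← Real.sqrt_mul' _ (sq_nonneg _)]
    exact Real.le_sqrt_of_sq_le h3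
  have h3 : N ≤ √(N ^ 2 - 1 / c) := T.opNorm_le_bound (Real.sqrt_nonneg _) h2
  have h4 := (Real.le_sqrt' h0).1 h3
  have : 0 < 1 / c := by positivity
  linarith

end SelfAdjoint

/-! ### The adjacency operator: symmetry and the Schur test -/

section Adjacency

variable {V : Type*} (𝕜 : Type*) [RCLike 𝕜] (G : SimpleGraph V) [G.LocallyFinite]
  (hG : BoundedDegree G)

theorem adjacencyOperator_single [DecidableEq V] (w : V) :
    adjacencyOperator 𝕜 G hG (lp.single 2 w 1) = ∑ v ∈ G.neighborFinset w, lp.single 2 v 1 := by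
  ext v
  rw [adjacencyOperator_apply]
  rw [lp.coeFn_sum]
  refine Eq.trans ?_ (Finset.sum_apply v (G.neighborFinset w)
    fun i => (Pi.single i 1 : V → 𝕜)).symm
  simp only [lp.coeFn_single, Pi.single_apply, Finset.sum_ite_eq, Finset.sum_ite_eq']
  exact if_congr (by rw [G.mem_neighborFinset, G.mem_neighborFinset, G.adj_comm]) rfl rfl

theorem inner_adjacencyOperator (f g : lp (fun _ : V => 𝕜) 2) :
    inner 𝕜 (adjacencyOperator 𝕜 G hG f) g = inner 𝕜 f (adjacencyOperator 𝕜 G hG g) := by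
  classical
  suffices h : adjacencyOperator 𝕜 G hG
      = ContinuousLinearMap.adjoint (adjacencyOperator 𝕜 G hG) from
    ((ContinuousLinearMap.eq_adjoint_iff _ _).1 h) f g
  ext g w
  have h1 : ∀ (g : lp (fun _ : V => 𝕜) 2) w, g w = inner 𝕜 (lp.single 2 w (1 : 𝕜)) g := by
    intro g w
    rw [lp.inner_single_left]
    simp
  rw [h1 (ContinuousLinearMap.adjoint _ g), ContinuousLinearMap.adjoint_inner_right,
    adjacencyOperator_single, sum_inner, adjacencyOperator_apply]
  simp_rw [← h1]

/-- The Schur test: a positive weight `μ` with `A μ ≤ c μ` bounds the norm of `A` by `c`. -/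
theorem norm_adjacencyOperator_le {μ : V → ℝ≥0} (hμ : IsWeight μ) {c : ℝ≥0}
    (h : ∀ v, ∑ w ∈ G.neighborFinset v, μ w ≤ c * μ v) :
    ‖adjacencyOperator 𝕜 G hG‖ ≤ c := by
  classical
  refine ContinuousLinearMap.opNorm_le_bound _ c.2 fun f => ?_
  refine lp.norm_le_of_forall_sum_le (by simp) (by positivity) fun s => ?_
  have h2 : (2 : ℝ≥0∞).toReal = ((2 : ℕ) : ℝ) := by simp
  have hf : ∀ t : Finset V, ∑ w ∈ t, ‖f w‖ ^ 2 ≤ ‖f‖ ^ 2 := by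
    intro t
    have := lp.sum_rpow_le_norm_rpow (p := 2) (by simp) f t
    simpa only [h2, Real.rpow_natCast] using this
  simp only [h2, Real.rpow_natCast, adjacencyOperator_apply]
  have hμ' : ∀ v, (0 : ℝ) < μ v := fun v => NNReal.coe_pos.2 (hμ v)
  have h' : ∀ v, ∑ w ∈ G.neighborFinset v, (μ w : ℝ) ≤ c * μ v := fun v => mod_cast h v
  -- Cauchy–Schwarz for the splitting `f = √μ · (f / √μ)`, followed by `A μ ≤ c μ` at `v`.
  have h1 : ∀ v, ‖∑ w ∈ G.neighborFinset v, f w‖ ^ 2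
      ≤ ∑ w ∈ G.neighborFinset v, c * μ v * (‖f w‖ ^ 2 / μ w) := by
    intro v
    calc ‖∑ w ∈ G.neighborFinset v, f w‖ ^ 2
        ≤ (∑ w ∈ G.neighborFinset v, ‖f w‖) ^ 2 := by
          gcongr
          exact norm_sum_le _ _
      _ ≤ (∑ w ∈ G.neighborFinset v, (μ w : ℝ)) * ∑ w ∈ G.neighborFinset v, ‖f w‖ ^ 2 / μ w :=
          Finset.sum_sq_le_sum_mul_sum_of_sq_le_mul _ (fun w _ => (hμ' w).le)
            (fun w _ => div_nonneg (sq_nonneg _) (hμ' w).le)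
            (fun w _ => (mul_div_cancel₀ _ (hμ' w).ne').ge)
      _ ≤ c * μ v * ∑ w ∈ G.neighborFinset v, ‖f w‖ ^ 2 / μ w :=
          mul_le_mul_of_nonneg_right (h' v)
            (Finset.sum_nonneg fun w _ => div_nonneg (sq_nonneg _) (hμ' w).le)
      _ = _ := Finset.mul_sum _ _ _
  set t : Finset V := s.biUnion fun v => G.neighborFinset v
  calc ∑ v ∈ s, ‖∑ w ∈ G.neighborFinset v, f w‖ ^ 2
      ≤ ∑ v ∈ s, ∑ w ∈ G.neighborFinset v, c * μ v * (‖f w‖ ^ 2 / μ w) :=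
        Finset.sum_le_sum fun v _ => h1 v
    _ = ∑ w ∈ t, ∑ v ∈ s with G.Adj v w, c * μ v * (‖f w‖ ^ 2 / μ w) := by
        refine Finset.sum_comm' fun v w => ?_
        simp only [t, Finset.mem_biUnion, Finset.mem_filter, SimpleGraph.mem_neighborFinset]
        exact ⟨fun h => ⟨h, v, h⟩, fun h => h.1⟩
    _ ≤ ∑ w ∈ t, (c : ℝ) ^ 2 * ‖f w‖ ^ 2 := by
        refine Finset.sum_le_sum fun w _ => ?_
        -- Second use of `A μ ≤ c μ`, now at `w`, by symmetry of adjacency.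
        have h3 : ∑ v ∈ s with G.Adj v w, (μ v : ℝ) ≤ c * μ w := by
          refine le_trans (Finset.sum_le_sum_of_subset_of_nonneg ?_ fun v _ _ => (hμ' v).le) (h' w)
          intro v hv
          simpa [SimpleGraph.adj_comm] using (Finset.mem_filter.1 hv).2
        rw [← Finset.sum_mul, ← Finset.mul_sum]
        calc c * (∑ v ∈ s with G.Adj v w, (μ v : ℝ)) * (‖f w‖ ^ 2 / μ w)
            ≤ c * (c * μ w) * (‖f w‖ ^ 2 / μ w) := by
              gcongr
          _ = _ := by
              have := (hμ' w).ne'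
              field_simp
    _ ≤ (c * ‖f‖) ^ 2 := by
        rw [← Finset.mul_sum, mul_pow]
        gcongr
        exact hf t

theorem spectralRadius_adjacencyOperator [Nonempty V] :
    spectralRadius 𝕜 (adjacencyOperator 𝕜 G hG) = ‖adjacencyOperator 𝕜 G hG‖₊ := by
  classical
  obtain ⟨v⟩ := ‹Nonempty V›
  have : Nontrivial (lp (fun _ : V => 𝕜) 2) :=
    ⟨lp.single 2 v 1, 0, fun h => by simpa using congrArg (fun f => f v) h⟩
  exact le_antisymm (spectrum.spectralRadius_le_nnnorm _)
    (nnnorm_le_spectralRadius (inner_adjacencyOperator 𝕜 G hG))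

end Adjacency

variable {V : Type*}

/-! ### Walk counts as matrix entries of powers of `A` -/

section WalkCount

open Classical in
/-- The number of walks of length `n` from `w` to `u`, i.e. the entry `(w, u)` of the `n`-th power
of the adjacency matrix. -/
noncomputable def walkCount (G : SimpleGraph V) [G.LocallyFinite] : ℕ → V → V → ℕ
  | 0, u, w => if w = u then 1 else 0
  | n + 1, u, w => ∑ w' ∈ G.neighborFinset w, walkCount G n u w'

variable (G : SimpleGraph V) [G.LocallyFinite]

theorem adjacencyOperator_pow_single [DecidableEq V] (𝕜 : Type*) [RCLike 𝕜]
    (hG : BoundedDegree G) (n : ℕ) (u w : V) :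
    (adjacencyOperator 𝕜 G hG ^ n) (lp.single 2 u 1) w = (walkCount G n u w : 𝕜) := by
  induction n generalizing w with
  | zero => simp [walkCount, Pi.single_apply]
  | succ n ih =>
    rw [pow_succ', mul_apply_eq_comp, adjacencyOperator_apply, walkCount,
      Nat.cast_sum]
    exact Finset.sum_congr rfl fun w' _ => ih w'

/-- The count is a coordinate of `Aⁿ δ_u`, and `δ_u` has norm one. -/
theorem walkCount_le (𝕜 : Type*) [RCLike 𝕜] (hG : BoundedDegree G) (n : ℕ) (u w : V) :
    (walkCount G n u w : ℝ≥0∞) ≤ (‖adjacencyOperator 𝕜 G hG‖₊ : ℝ≥0∞) ^ n := by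
  classical
  set A := adjacencyOperator 𝕜 G hG
  suffices h : (walkCount G n u w : ℝ) ≤ ‖A‖ ^ n by
    have h' : (walkCount G n u w : ℝ≥0) ≤ ‖A‖₊ ^ n := by exact_mod_cast h
    exact_mod_cast h'
  have hpow : ∀ f : lp (fun _ : V => 𝕜) 2, ‖(A ^ n) f‖ ≤ ‖A‖ ^ n * ‖f‖ := by
    induction n with
    | zero => simp
    | succ n ih =>
      intro f
      rw [pow_succ', mul_apply_eq_comp, pow_succ', mul_assoc]
      exact (A.le_opNorm _).trans (by gcongr; exact ih f)
  calc (walkCount G n u w : ℝ) = ‖(A ^ n) (lp.single 2 u 1) w‖ := by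
        rw [adjacencyOperator_pow_single, RCLike.norm_natCast]
    _ ≤ ‖(A ^ n) (lp.single 2 u 1)‖ := lp.norm_apply_le_norm (by simp) _ _
    _ ≤ ‖A‖ ^ n := by simpa using hpow (lp.single 2 u 1)

theorem walkCount_eq_zero {G : SimpleGraph V} [G.LocallyFinite] (hconn : G.Connected) {n : ℕ}
    {u w : V} (h : n < G.dist w u) : walkCount G n u w = 0 := by
  induction n generalizing w with
  | zero =>
    rw [walkCount, if_neg]
    rintro rfl
    simp at h
  | succ n ih =>
    rw [walkCount]
    refine Finset.sum_eq_zero fun w' hw' => ih ?_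
    have h1 := SimpleGraph.dist_eq_one_iff_adj.2 ((G.mem_neighborFinset w w').1 hw')
    have := hconn.dist_triangle (u := w) (v := w') (w := u)
    omega

end WalkCount

/-! ### Green function and potentials -/

section Green

variable (G : SimpleGraph V) [G.LocallyFinite]

/-- The Green function `∑ₙ Aⁿ tⁿ`. -/
noncomputable def green (t : ℝ≥0) (u w : V) : ℝ≥0∞ :=
  ∑' n : ℕ, (walkCount G n u w : ℝ≥0∞) * t ^ n

/-- Applying `t A` shifts the series by one index; only the term `n = 0` is lost. Values in `ℝ≥0∞`
make convergence irrelevant here. -/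
theorem mul_sum_green_le (t : ℝ≥0) (u w : V) :
    t * ∑ w' ∈ G.neighborFinset w, green G t u w' ≤ green G t u w := by
  have h : t * ∑ w' ∈ G.neighborFinset w, green G t u w'
      = ∑' n : ℕ, (walkCount G (n + 1) u w : ℝ≥0∞) * t ^ (n + 1) := by
    simp only [green]
    rw [← Summable.tsum_finsetSum fun _ _ => ENNReal.summable, ← ENNReal.tsum_mul_left]
    refine tsum_congr fun n => ?_
    rw [walkCount, Nat.cast_sum, ← Finset.sum_mul]
    ring
  rw [h]
  exact ENNReal.tsum_comp_le_tsum_of_injective (add_left_injective 1)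
    (fun n => (walkCount G n u w : ℝ≥0∞) * t ^ n)

theorem one_le_green_self (t : ℝ≥0) (u : V) : 1 ≤ green G t u u := by
  refine le_trans ?_ (ENNReal.le_tsum 0)
  simp [walkCount]

variable {G} in
theorem green_ne_top (𝕜 : Type*) [RCLike 𝕜] (hG : BoundedDegree G) {t : ℝ≥0}
    (ht : ‖adjacencyOperator 𝕜 G hG‖₊ * t < 1) (u w : V) : green G t u w ≠ ∞ := by
  have h : green G t u w
      ≤ ∑' n : ℕ, ((‖adjacencyOperator 𝕜 G hG‖₊ * t : ℝ≥0) : ℝ≥0∞) ^ n := by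
    refine ENNReal.tsum_le_tsum fun n => ?_
    rw [ENNReal.coe_mul, mul_pow]
    gcongr
    exact walkCount_le G 𝕜 hG n u w
  refine ne_top_of_le_ne_top ?_ h
  rw [ENNReal.tsum_geometric, ENNReal.inv_ne_top]
  exact (tsub_pos_of_lt (by exact_mod_cast ht)).ne'

variable {G} in
-- By `mul_sum_green_le` a zero spreads to all neighbours, hence along a walk to `u`, where the
-- value is at least 1.
theorem green_ne_zero (hconn : G.Connected) {t : ℝ≥0} (ht : t ≠ 0) (u w : V) :
    green G t u w ≠ 0 := by
  intro h
  have hstep : ∀ a b, G.Reachable a b → green G t u a = 0 → green G t u b = 0 := by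
    rintro a b ⟨p⟩
    induction p with
    | nil => exact id
    | @cons a b c hab _ ih =>
      intro h0
      refine ih ?_
      have h1 := mul_sum_green_le G t u a
      rw [h0, nonpos_iff_eq_zero, mul_eq_zero, Finset.sum_eq_zero_iff] at h1
      exact (h1.resolve_left (by exact_mod_cast ht)) b ((G.mem_neighborFinset a b).2 hab)
  have := one_le_green_self G t u
  rw [hstep w u (hconn w u) h] at this
  simp at this

/-- The potential of `ν`. -/
noncomputable def potential (t : ℝ≥0) (ν : V → ℝ≥0) (w : V) : ℝ≥0∞ :=
  ∑' u, green G t u w * ν u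

theorem mul_sum_potential_le (t : ℝ≥0) (ν : V → ℝ≥0) (w : V) :
    t * ∑ w' ∈ G.neighborFinset w, potential G t ν w' ≤ potential G t ν w := by
  simp only [potential]
  rw [← Summable.tsum_finsetSum fun _ _ => ENNReal.summable, ← ENNReal.tsum_mul_left]
  refine ENNReal.tsum_le_tsum fun u => ?_
  rw [← Finset.sum_mul, ← mul_assoc]
  gcongr
  exact mul_sum_green_le G t u w

theorem le_potential (t : ℝ≥0) (ν : V → ℝ≥0) (w : V) : ν w ≤ potential G t ν w := by
  refine le_trans ?_ (ENNReal.le_tsum w)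
  calc (ν w : ℝ≥0∞) = 1 * ν w := (one_mul _).symm
    _ ≤ _ := by
      gcongr
      exact one_le_green_self G t w

variable {G} in
-- After exchanging the sums, the `n`-th term involves only walks of length `n` from `w`, and these
-- stay in `B(w, n)`.
theorem potential_le (hconn : G.Connected) (𝕜 : Type*) [RCLike 𝕜] (hG : BoundedDegree G)
    (t : ℝ≥0) (ν : V → ℝ≥0) (w : V) :
    potential G t ν w
      ≤ ∑' n : ℕ, ((‖adjacencyOperator 𝕜 G hG‖₊ * t : ℝ≥0) : ℝ≥0∞) ^ n
        * mass ν (closedBall G w n) := by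
  classical
  simp only [potential, green, ← ENNReal.tsum_mul_right]
  rw [ENNReal.tsum_comm]
  refine ENNReal.tsum_le_tsum fun n => ?_
  rw [mass, tsum_subtype _ (fun v => (ν v : ℝ≥0∞)), ← ENNReal.tsum_mul_left]
  refine ENNReal.tsum_le_tsum fun u => ?_
  by_cases hu : u ∈ closedBall G w n
  · rw [Set.indicator_of_mem hu, ENNReal.coe_mul, mul_pow]
    gcongr
    exact walkCount_le G 𝕜 hG n u w
  · rw [Set.indicator_of_notMem hu, walkCount_eq_zero hconn (by simpa [closedBall] using hu)]
    simp

end Green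

/-! ### Growth and stability of doubling measures -/

section Doubling

variable {G : SimpleGraph V} {μ ν : V → ℝ≥0}

theorem mass_mono {S T : Set V} (h : S ⊆ T) : mass μ S ≤ mass μ T :=
  ENNReal.tsum_mono_subtype (fun v => (μ v : ℝ≥0∞)) h

theorem le_mass {S : Set V} {v : V} (h : v ∈ S) : μ v ≤ mass μ S :=
  ENNReal.le_tsum (f := fun v : S => (μ v : ℝ≥0∞)) ⟨v, h⟩

theorem mass_singleton (v : V) : mass μ {v} = μ v :=
  tsum_singleton v fun v => (μ v : ℝ≥0∞)

theorem mem_closedBall_self {v : V} {r : ℝ} (hr : 0 ≤ r) : v ∈ closedBall G v r := by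
  simpa [closedBall] using hr

theorem closedBall_eq_singleton (hconn : G.Connected) {v : V} {r : ℝ} (h0 : 0 ≤ r) (h1 : r < 1) :
    closedBall G v r = {v} := by
  ext w
  rw [Set.mem_singleton_iff, eq_comm]
  constructor
  · intro h
    rw [← hconn.dist_eq_zero_iff]
    have : (G.dist v w : ℝ) < 1 := lt_of_le_of_lt h h1
    exact Nat.lt_one_iff.1 (by exact_mod_cast this)
  · rintro rfl
    exact mem_closedBall_self h0

theorem mass_closedBall_two_mul_le (hμ : IsWeight μ) {C : ℝ≥0∞} (hC : doublingConst G μ ≤ C)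
    (h1 : 1 ≤ C) (v : V) {r : ℝ} (hr : 0 ≤ r) :
    mass μ (closedBall G v (2 * r)) ≤ C * mass μ (closedBall G v r) := by
  have h0 : mass μ (closedBall G v r) ≠ 0 := fun h => by
    have := le_mass (μ := μ) (mem_closedBall_self (G := G) (v := v) hr)
    rw [h] at this
    exact (hμ v).ne' (by simpa using this)
  -- For a ball of infinite mass the quotient carries no information, since `∞ / ∞ = 0`; the bound
  -- then holds because `C ≠ 0`.
  by_cases htop : mass μ (closedBall G v r) = ∞
  · rw [htop, ENNReal.mul_top (zero_lt_one.trans_le h1).ne']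
    exact le_top
  · rw [← ENNReal.div_le_iff h0 htop]
    refine le_trans ?_ hC
    exact le_iSup₂_of_le v r (le_iSup_of_le hr le_rfl)

theorem mass_closedBall_two_pow_le (hconn : G.Connected) (hμ : IsWeight μ) {C : ℝ≥0∞}
    (hC : doublingConst G μ ≤ C) (h1 : 1 ≤ C) (v : V) (k : ℕ) :
    mass μ (closedBall G v (2 ^ k)) ≤ C ^ (k + 1) * μ v := by
  induction k with
  | zero =>
    -- `B(v, 1/2)` is `{v}`, so one doubling already leads from the point to radius 1; hence the
    -- exponent `k + 1`.
    have := mass_closedBall_two_mul_le hμ hC h1 v (r := 1 / 2) (by norm_num)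
    rw [closedBall_eq_singleton hconn (r := 1 / 2) (by norm_num) (by norm_num), mass_singleton,
      mul_one_div_cancel two_ne_zero] at this
    simpa using this
  | succ k ih =>
    rw [pow_succ' (2 : ℝ), pow_succ' C, mul_assoc]
    exact (mass_closedBall_two_mul_le hμ hC h1 v (by positivity)).trans (by gcongr)

/-- Balls of a doubling measure grow polynomially. -/
theorem IsDoubling.exists_mass_closedBall_le (hconn : G.Connected) (hμ : IsDoubling G μ) :
    ∃ p : ℕ, ∀ v (n : ℕ),
      mass μ (closedBall G v n) ≤ (4 * (n + 1) : ℝ≥0∞) ^ p * μ v := by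
  -- Rounding the constant up to `2 ^ p` turns its power with exponent `log₂ n + 2` into the `p`-th
  -- power of `2 ^ (log₂ n + 2) ≤ 4 (n + 1)`.
  obtain ⟨m, hm⟩ := ENNReal.exists_nat_gt hμ.2.ne
  obtain ⟨p, hp⟩ := pow_unbounded_of_one_lt m (one_lt_two : 1 < 2)
  refine ⟨p, fun v n => ?_⟩
  have hC : doublingConst G μ ≤ 2 ^ p := hm.le.trans (by exact_mod_cast hp.le)
  have h1 : (1 : ℝ≥0∞) ≤ 2 ^ p := one_le_pow₀ one_le_two
  have hn : n ≤ 2 ^ (Nat.log 2 n + 1) := (Nat.lt_pow_succ_log_self one_lt_two n).le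
  have hlog : 2 ^ (Nat.log 2 n + 1 + 1) ≤ 4 * (n + 1) := by
    rcases eq_or_ne n 0 with rfl | h0
    · simp
    · have := Nat.pow_log_le_self 2 h0
      rw [pow_succ, pow_succ]
      omega
  calc mass μ (closedBall G v n) ≤ mass μ (closedBall G v (2 ^ (Nat.log 2 n + 1))) :=
        mass_mono fun w hw => le_trans (show (G.dist v w : ℝ) ≤ n from hw) (by exact_mod_cast hn)
    _ ≤ (2 ^ p) ^ (Nat.log 2 n + 1 + 1) * μ v := mass_closedBall_two_pow_le hconn hμ.1 hC h1 v _
    _ = (2 ^ (Nat.log 2 n + 1 + 1)) ^ p * μ v := by rw [← pow_mul, ← pow_mul, mul_comm p]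
    _ ≤ _ := by
      gcongr
      exact_mod_cast hlog

/-- Ball masses are comparable, so each doubling quotient grows by a factor of at most `K`. -/
theorem IsDoubling.of_le_of_le (hν : IsDoubling G ν) (h1 : ∀ v, ν v ≤ μ v) {K : ℝ≥0}
    (h2 : ∀ v, μ v ≤ K * ν v) : IsDoubling G μ := by
  refine ⟨fun v => (hν.1 v).trans_le (h1 v), ?_⟩
  have hS : ∀ S : Set V, mass ν S ≤ mass μ S := fun S =>
    ENNReal.tsum_le_tsum fun v => by exact_mod_cast h1 v
  have hS' : ∀ S : Set V, mass μ S ≤ K * mass ν S := fun S => by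
    rw [mass, mass, ← ENNReal.tsum_mul_left]
    exact ENNReal.tsum_le_tsum fun v => by exact_mod_cast h2 v
  refine lt_of_le_of_lt (b := K * doublingConst G ν) ?_
    (ENNReal.mul_lt_top ENNReal.coe_lt_top hν.2)
  refine iSup₂_le fun v r => iSup_le fun hr => ?_
  refine (ENNReal.div_le_div (hS' _) (hS _)).trans ?_
  rw [mul_div_assoc]
  gcongr
  exact le_iSup₂_of_le v r (le_iSup_of_le hr le_rfl)

theorem tsum_geometric_mul_pow_ne_top {q : ℝ≥0} (hq : q < 1) (p : ℕ) :
    ∑' n : ℕ, (q : ℝ≥0∞) ^ n * (4 * (n + 1) : ℝ≥0∞) ^ p ≠ ∞ := by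
  have h : Summable fun n : ℕ => q ^ n * (4 * ((n : ℝ≥0) + 1)) ^ p := by
    rcases eq_or_ne q 0 with rfl | h0
    · refine summable_of_ne_finset_zero (s := {0}) fun n hn => ?_
      rw [zero_pow (by simpa using hn), zero_mul]
    have h1 : Summable fun n : ℕ => (n : ℝ) ^ p * (q : ℝ) ^ n :=
      summable_pow_mul_geometric_of_norm_lt_one p (by simpa using hq)
    -- The index shift produces `(n + 1) ^ p` with a surplus factor `q`, which is divided out; this
    -- is why `q = 0` is separate.
    have h2 := ((summable_nat_add_iff 1).2 h1).mul_left (4 ^ p * (q : ℝ)⁻¹)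
    rw [← NNReal.summable_coe]
    refine h2.congr fun n => ?_
    have : (q : ℝ) ≠ 0 := by exact_mod_cast h0
    push_cast
    rw [pow_succ (q : ℝ), mul_pow]
    field_simp
  have := ENNReal.tsum_coe_ne_top_iff_summable.2 h
  simpa using this

end Doubling

/-! ### The constant `C_μ^0` and the two bounds -/

section RestrictedConst

variable {G : SimpleGraph V} [G.LocallyFinite] {μ : V → ℝ≥0}

theorem mass_closedBall_one (hconn : G.Connected) (v : V) :
    mass μ (closedBall G v 1) = μ v + ∑ w ∈ G.neighborFinset v, (μ w : ℝ≥0∞) := by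
  classical
  have h : closedBall G v 1 = ↑(insert v (G.neighborFinset v)) := by
    ext w
    have : w ∈ closedBall G v 1 ↔ G.dist v w ≤ 1 := by simp [closedBall]
    rw [this, Nat.le_one_iff_eq_zero_or_eq_one, hconn.dist_eq_zero_iff,
      SimpleGraph.dist_eq_one_iff_adj]
    simp [eq_comm]
  rw [h, mass, Finset.tsum_subtype' _ fun v => (μ v : ℝ≥0∞), Finset.sum_insert (by simp)]

/-- The quotient at `v` is `1 + (A μ)(v) / μ(v)`. -/
theorem restrictedConst_zero_le_iff (hconn : G.Connected) (hμ : IsWeight μ) (c : ℝ≥0) :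
    restrictedConst G 0 μ ≤ 1 + c ↔ ∀ v, ∑ w ∈ G.neighborFinset v, μ w ≤ c * μ v := by
  rw [restrictedConst, iSup_le_iff]
  refine forall_congr' fun v => ?_
  have h0 : closedBall G v ((0 : ℕ) : ℝ) = {v} :=
    closedBall_eq_singleton hconn (by simp) (by simp)
  have h1 : (2 * ((0 : ℕ) : ℝ) + 1) = 1 := by simp
  rw [h0, h1, mass_singleton, mass_closedBall_one hconn,
    ENNReal.div_le_iff (by exact_mod_cast (hμ v).ne') ENNReal.coe_ne_top, add_mul, one_mul,
    ENNReal.add_le_add_iff_left ENNReal.coe_ne_top]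
  exact_mod_cast Iff.rfl

/-- Holds for every weight, so it bounds both infima from below. -/
theorem one_add_spectralRadius_le (𝕜 : Type*) [RCLike 𝕜] (hconn : G.Connected)
    (hG : BoundedDegree G) (hμ : IsWeight μ) :
    1 + spectralRadius 𝕜 (adjacencyOperator 𝕜 G hG) ≤ restrictedConst G 0 μ := by
  have := hconn.nonempty
  rw [spectralRadius_adjacencyOperator]
  by_cases htop : restrictedConst G 0 μ = ∞
  · simp [htop]
  have h1 : 1 ≤ restrictedConst G 0 μ := by
    obtain ⟨v⟩ := this
    refine le_iSup_of_le v ?_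
    rw [closedBall_eq_singleton (r := ((0 : ℕ) : ℝ)) hconn (by simp) (by simp), mass_singleton,
      ENNReal.le_div_iff_mul_le (by simp [(hμ v).ne']) (by simp), one_mul]
    exact le_mass (mem_closedBall_self (by positivity))
  obtain ⟨c, hc⟩ := exists_add_of_le h1
  lift c to ℝ≥0 using by rintro rfl; simp [hc] at htop
  have h := norm_adjacencyOperator_le 𝕜 G hG hμ
    ((restrictedConst_zero_le_iff hconn hμ c).1 hc.le)
  rw [hc]
  gcongr
  exact h

/-- The weight is the Green function at `t = s⁻¹` with an arbitrary pole `u`. -/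
theorem exists_isWeight_restrictedConst_le (𝕜 : Type*) [RCLike 𝕜] (hconn : G.Connected)
    (hG : BoundedDegree G) {s : ℝ≥0} (hs : ‖adjacencyOperator 𝕜 G hG‖₊ < s) :
    ∃ μ : V → ℝ≥0, IsWeight μ ∧ restrictedConst G 0 μ ≤ 1 + s := by
  obtain ⟨u⟩ := hconn.nonempty
  have hs0 : s ≠ 0 := (pos_of_gt hs).ne'
  have hq : ‖adjacencyOperator 𝕜 G hG‖₊ * s⁻¹ < 1 := by
    rwa [← div_eq_mul_inv, div_lt_one₀ (pos_of_gt hs)]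
  have hne := green_ne_top 𝕜 hG hq u
  have hμ : IsWeight fun w => (green G s⁻¹ u w).toNNReal := fun w =>
    ENNReal.toNNReal_pos (green_ne_zero hconn (inv_ne_zero hs0) u w) (hne w)
  refine ⟨_, hμ, (restrictedConst_zero_le_iff hconn hμ s).2 fun v => ?_⟩
  rw [← inv_mul_le_iff₀ (pos_of_gt hs), ← ENNReal.coe_le_coe]
  push_cast
  simpa only [ENNReal.coe_toNNReal (hne _), ENNReal.coe_inv hs0] using mul_sum_green_le G s⁻¹ u v

/-- A single pole need not give a doubling weight, so the source is `ν` itself. The `n`-th term of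
its potential is at most `q ^ n (4 (n + 1)) ^ p ν(w)` with `q = ‖A‖ / s < 1`, which sums to a
constant `K` independent of `w`. -/
theorem IsDoubling.exists_restrictedConst_le (𝕜 : Type*) [RCLike 𝕜] (hconn : G.Connected)
    (hG : BoundedDegree G) {ν : V → ℝ≥0} (hν : IsDoubling G ν) {s : ℝ≥0}
    (hs : ‖adjacencyOperator 𝕜 G hG‖₊ < s) :
    ∃ μ : V → ℝ≥0, IsDoubling G μ ∧ restrictedConst G 0 μ ≤ 1 + s := by
  have hs0 : s ≠ 0 := (pos_of_gt hs).ne'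
  have hq : ‖adjacencyOperator 𝕜 G hG‖₊ * s⁻¹ < 1 := by
    rwa [← div_eq_mul_inv, div_lt_one₀ (pos_of_gt hs)]
  obtain ⟨p, hp⟩ := hν.exists_mass_closedBall_le hconn
  obtain ⟨K, hK⟩ := WithTop.ne_top_iff_exists.1 (tsum_geometric_mul_pow_ne_top hq p)
  have hle : ∀ w, potential G s⁻¹ ν w ≤ K * ν w := by
    intro w
    refine (potential_le hconn 𝕜 hG s⁻¹ ν w).trans ?_
    rw [show (K : ℝ≥0∞) = _ from hK, ← ENNReal.tsum_mul_right]
    refine ENNReal.tsum_le_tsum fun n => ?_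
    rw [mul_assoc]
    gcongr
    exact hp w n
  have hne : ∀ w, potential G s⁻¹ ν w ≠ ∞ := fun w =>
    ne_top_of_le_ne_top (by finiteness) (hle w)
  have hμ : IsDoubling G fun w => (potential G s⁻¹ ν w).toNNReal := by
    refine hν.of_le_of_le (K := K) (fun w => ?_) fun w => ?_
    · rw [← ENNReal.coe_le_coe, ENNReal.coe_toNNReal (hne w)]
      exact le_potential G s⁻¹ ν w
    · rw [← ENNReal.coe_le_coe, ENNReal.coe_toNNReal (hne w), ENNReal.coe_mul]
      exact hle w
  refine ⟨_, hμ, (restrictedConst_zero_le_iff hconn hμ.1 s).2 fun v => ?_⟩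
  rw [← inv_mul_le_iff₀ (pos_of_gt hs), ← ENNReal.coe_le_coe]
  push_cast
  simpa only [ENNReal.coe_toNNReal (hne _), ENNReal.coe_inv hs0]
    using mul_sum_potential_le G s⁻¹ ν v

end RestrictedConst

end GraphDoubling

theorem theorem3p5 {𝕜 : Type*} [RCLike 𝕜] {V : Type*} (G : SimpleGraph V) [G.LocallyFinite]
    (hconn : G.Connected) (hdeg : GraphDoubling.BoundedDegree G) :
    ((∃ μ : V → ℝ≥0, GraphDoubling.IsDoubling G μ) →
      GraphDoubling.leastRestrictedConst G 0 =
        1 + spectralRadius 𝕜 (GraphDoubling.adjacencyOperator 𝕜 G hdeg)) ∧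
    GraphDoubling.leastRestrictedConstAll G 0 =
      1 + spectralRadius 𝕜 (GraphDoubling.adjacencyOperator 𝕜 G hdeg) := by
  have := hconn.nonempty
  -- The geometric bounds need `s > ‖A‖` strictly, so the value at `‖A‖` is reached through `s = ‖A‖
  -- + ε`.
  have hlim : ∀ x : ℝ≥0∞,
      (∀ s : ℝ≥0, ‖GraphDoubling.adjacencyOperator 𝕜 G hdeg‖₊ < s → x ≤ 1 + s) →
        x ≤ 1 + spectralRadius 𝕜 (GraphDoubling.adjacencyOperator 𝕜 G hdeg) := by
    intro x hx
    rw [GraphDoubling.spectralRadius_adjacencyOperator]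
    refine ENNReal.le_of_forall_pos_le_add fun ε hε _ => ?_
    rw [add_assoc]
    exact_mod_cast hx _ (lt_add_of_pos_right _ hε)
  refine ⟨?_, le_antisymm (hlim _ fun s hs => ?_) ?_⟩
  · rintro ⟨ν, hν⟩
    refine le_antisymm (hlim _ fun s hs => ?_) ?_
    · obtain ⟨μ, hμ, h⟩ := hν.exists_restrictedConst_le 𝕜 hconn hdeg hs
      exact iInf₂_le_of_le μ hμ h
    · exact le_iInf₂ fun μ hμ => GraphDoubling.one_add_spectralRadius_le 𝕜 hconn hdeg hμ.1
  · obtain ⟨μ, hμ, h⟩ := GraphDoubling.exists_isWeight_restrictedConst_le 𝕜 hconn hdeg hs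
    exact iInf₂_le_of_le μ hμ h
  · exact le_iInf₂ fun μ hμ => GraphDoubling.one_add_spectralRadius_le 𝕜 hconn hdeg hμ
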